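/- Let $\Lambda\ge 1$, $N\ge 1$ and $0\le K\le N$ be integers. A server has $N$ files of $B$ bits each and is connected by an error-free broadcast link to $K$ users; there are $\Lambda$ caches, each able to store $MB$ bits, where $0\le M\le N$. A connectivity is a vector $b=(K_{\mathcal U,b})_{\mathcal U\subseteq[\Lambda]}$ of non-negative integers with $\sum_{\mathcal U}K_{\mathcal U,b}=K$, where $K_{\mathcal U,b}$ is the number of users that have access to exactly the caches in $\mathcal U$. Let $\mathcal B$ be the set of all connectivities. A scheme consists of a file size $B\ge1$, an uncoded placement (each cache stores a selection of at most $MB$ bits of the library) that does not depend on the connectivity, and, for each $b\in\mathcal B$ and each demand (a choice of one file by each user), a delivery procedure: the server broadcasts a number of bits, depending on $b$ and the demand only, whose values are a function of the library, such that each user can recover its requested file from the broadcast and the contents of its caches, for every content of the library. The worst-case load $R_b$ of the scheme is the maximum over all demands of the number of broadcast bits divided by $B$, and its average worst-case load is $\frac1{|\mathcal B|}\sum_{b\in\mathcal B}R_b$ (all connectivities are equally likely). Let $R^\star_{\mathrm{avg},\mathcal B}(M)$ be the infimum of the average worst-case loads over all such schemes. Then $|\mathcal B|=\binom{K+2^\Lambda-1}{K}$,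 and for every real $M\in[0,N]$ $$R^\star_{\mathrm{avg},\mathcal B}(M)\ \ge\ R_{\mathrm{avg},\mathcal B,\mathrm{LB}}(M),$$ where $R_{\mathrm{avg},\mathcal B,\mathrm{LB}}$ is the piecewise-linear curve on $[0,N]$ with corner points $$\left(t\,\frac N\Lambda,\ \sum_{\lambda=0}^{\Lambda}\left[\frac{K\binom{\Lambda}{t+\lambda}}{2^\Lambda\binom{\Lambda}{t}}+A_{t,\lambda}\right]\right),\quad t=0,1,\dots,\Lambda,\qquad A_{t,\lambda}=\frac{K}{|\mathcal B|}\binom{\Lambda-t}{\lambda}\left(1-\frac1{\binom{t+\lambda}{\lambda}}\right),$$ with the convention $\binom nk=0$ for $k>n$. -/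

import Mathlib

/-! Multi-access coded caching with `Λ` caches, `K` users and `N` files: connectivities, schemes with
uncoded placement, average worst-case load, and the piecewise-linear lower bound. -/

namespace MACC

/-- The ensemble of all connectivities of `K` users to `Λ` caches. A connectivity `b` gives, for each
set `U` of caches, the number `b U` of users connected to exactly the caches in `U`. -/
def ensemble (Λ K : ℕ) : Finset (Finset (Fin Λ) → ℕ) :=
  Finset.piAntidiag Finset.univ K

theorem mem_ensemble {Λ K : ℕ} {b : Finset (Fin Λ) → ℕ} :
    b ∈ ensemble Λ K ↔ ∑ U, b U = K := by
  simp [ensemble]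

/-- The users of the connectivity `b`: the pair `⟨U, k⟩` is the `k`-th user connected to exactly the
caches in `U`. -/
abbrev User {Λ : ℕ} (b : Finset (Fin Λ) → ℕ) : Type :=
  (U : Finset (Fin Λ)) × Fin (b U)

/-- A demand: the index of the file requested by each user. -/
abbrev Demand {Λ : ℕ} (N : ℕ) (b : Finset (Fin Λ) → ℕ) : Type :=
  User b → Fin N

/-- A library of `N` files of `B` bits each. -/
abbrev Library (N B : ℕ) : Type :=
  Fin N → Fin B → Bool

/-- The library bits that are available to a user connected to the caches in `U`, when the cache `c`
stores the library bits with positions in `cache c`. -/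
def available {Λ N B : ℕ} (cache : Fin Λ → Finset (Fin N × Fin B)) (U : Finset (Fin Λ)) :
    Finset (Fin N × Fin B) :=
  U.biUnion cache

/-- A delivery procedure for the connectivity `b` and the demand `d`, given the cached bits: the server
broadcasts `length` bits that depend on the library, and every user recovers its requested file from
the broadcast and the bits in its caches, for every possible content of the library. -/
structure Delivery {Λ N B : ℕ} (cache : Fin Λ → Finset (Fin N × Fin B))
    (b : Finset (Fin Λ) → ℕ) (d : Demand N b) where
  length : ℕ
  encode : Library N B → (Fin length → Bool)
  decode : (u : User b) → (Fin length → Bool) → (available cache u.1 → Bool) → (Fin B → Bool)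
  correct : ∀ (W : Library N B) (u : User b),
    decode u (encode W) (fun p => W p.1.1 p.1.2) = W (d u)

/-- A caching scheme with memory `M` (in units of files) and uncoded placement: each cache stores a
selection of at most `M * B` bits of the library, the same for all connectivities, and there is a
delivery procedure for each connectivity of the ensemble and each demand. -/
structure Scheme (Λ K N : ℕ) (M : ℝ) where
  fileSize : ℕ
  fileSize_pos : 0 < fileSize
  cache : Fin Λ → Finset (Fin N × Fin fileSize)
  cache_card_le : ∀ c, ((cache c).card : ℝ) ≤ M * fileSize
  delivery : ∀ (b : ensemble Λ K) (d : Demand N b.1), Delivery cache b.1 d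

/-- The worst-case load for the connectivity `b`: the largest number of transmitted bits over all
demands, normalized by the file size. -/
noncomputable def Scheme.worstCaseLoad {Λ K N : ℕ} {M : ℝ} (S : Scheme Λ K N M)
    (b : ensemble Λ K) : ℝ :=
  ((Finset.univ.sup fun d : Demand N b.1 => (S.delivery b d).length : ℕ) : ℝ) / S.fileSize

/-- The average of the worst-case load over the equiprobable connectivities. -/
noncomputable def Scheme.averageLoad {Λ K N : ℕ} {M : ℝ} (S : Scheme Λ K N M) : ℝ :=
  (∑ b : ensemble Λ K, S.worstCaseLoad b) / (ensemble Λ K).card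

/-- The pair `(M, R)` is achievable: some scheme with memory `M` guarantees an average worst-case load
of at most `R`. -/
def Achievable (Λ K N : ℕ) (M R : ℝ) : Prop :=
  ∃ S : Scheme Λ K N M, S.averageLoad ≤ R

/-- The optimal average worst-case load over the ensemble of all connectivities. -/
noncomputable def optimalAverageLoad (Λ K N : ℕ) (M : ℝ) : ℝ :=
  sInf {R : ℝ | Achievable Λ K N M R}

/-- The term `A_{t,λ}`. -/
noncomputable def extraTerm (Λ K t l : ℕ) : ℝ :=
  (K : ℝ) / (ensemble Λ K).card * (Λ - t).choose l * (1 - 1 / (t + l).choose l)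

/-- The ordinate of the corner point with abscissa `t * N / Λ`. -/
noncomputable def cornerLoad (Λ K t : ℕ) : ℝ :=
  ∑ l ∈ Finset.range (Λ + 1),
    ((K : ℝ) * Λ.choose (t + l) / (2 ^ Λ * Λ.choose t) + extraTerm Λ K t l)

/-- The piecewise-linear curve on `[0, N]` with corner points `(t * N / Λ, cornerLoad Λ K t)`,
`0 ≤ t ≤ Λ`. -/
noncomputable def lowerBoundCurve (Λ K N : ℕ) (M : ℝ) : ℝ :=
  let s : ℝ := Λ * M / N
  cornerLoad Λ K ⌊s⌋₊ + (s - ⌊s⌋₊) * (cornerLoad Λ K (⌊s⌋₊ + 1) - cornerLoad Λ K ⌊s⌋₊)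

/-- The curve passes through the corner points. -/
theorem lowerBoundCurve_corner {Λ N : ℕ} (hΛ : 1 ≤ Λ) (hN : 1 ≤ N) (K t : ℕ) :
    lowerBoundCurve Λ K N (t * (N / Λ)) = cornerLoad Λ K t := by
  have h1 : (Λ : ℝ) ≠ 0 := by positivity
  have h2 : (N : ℝ) ≠ 0 := by positivity
  have h : (Λ : ℝ) * (t * (N / Λ)) / N = t := by field_simp
  simp [lowerBoundCurve, h]

/-- The curve is linear between consecutive corner points. -/
theorem lowerBoundCurve_segment {Λ N : ℕ} (hΛ : 1 ≤ Λ) (hN : 1 ≤ N) (K t : ℕ) {θ : ℝ}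
    (h0 : 0 ≤ θ) (h1 : θ ≤ 1) :
    lowerBoundCurve Λ K N ((1 - θ) * (t * (N / Λ)) + θ * ((t + 1) * (N / Λ))) =
      (1 - θ) * cornerLoad Λ K t + θ * cornerLoad Λ K (t + 1) := by
  rcases h1.eq_or_lt with rfl | h1
  · have := lowerBoundCurve_corner hΛ hN K (t + 1)
    push_cast at this
    simp [this]
  have h2 : (Λ : ℝ) ≠ 0 := by positivity
  have h3 : (N : ℝ) ≠ 0 := by positivity
  have h : (Λ : ℝ) * ((1 - θ) * (t * (N / Λ)) + θ * ((t + 1) * (N / Λ))) / N = t + θ := by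
    field_simp
    ring
  have hf : ⌊(t : ℝ) + θ⌋₊ = t := by
    rw [Nat.floor_eq_iff (by positivity)]
    constructor <;> linarith
  simp only [lowerBoundCurve, h, hf]
  ring

end MACC

/-! Order the caches by a permutation and enlarge each user's side information to the shortest
prefix of that order containing its caches. Users can then decode successively, so the broadcast
carries every requested bit missing from these prefixes (`Delivery.card_le_length`). Averaging over
cyclic shifts of an injective demand removes the dependence on files. If all users share the same
caches `U`, the prefix is unnecessary and `U` itself serves: this improves the bound for `2 ^ Λ`
connectivities and produces the terms `A_{t,λ}`.

Summing over connectivities (`Scheme.missing_le_sum_worstCaseLength`) and averaging over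
permutations, a library bit contributes an amount `profile` that depends only on how many caches
hold it. This function is convex and antitone and equals the corner ordinates, while memory bounds
the total number of cached copies. Jensen's inequality, by a supporting line (`tangent_le`), gives
the curve. -/

namespace MACC

/-! ### The acyclic index coding bound -/

/-- The number of library bits that are stored in none of the caches in `V`. -/
def missing {Λ N B : ℕ} (cache : Fin Λ → Finset (Fin N × Fin B)) (V : Finset (Fin Λ)) : ℕ :=
  ((available cache V)ᶜ).card

/-- The caches that store the library bit `p`. -/
def holders {Λ N B : ℕ} (cache : Fin Λ → Finset (Fin N × Fin B)) (p : Fin N × Fin B) :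
    Finset (Fin Λ) :=
  Finset.univ.filter fun c => p ∈ cache c

theorem notMem_available_iff {Λ N B : ℕ} {cache : Fin Λ → Finset (Fin N × Fin B)}
    {V : Finset (Fin Λ)} {p : Fin N × Fin B} :
    p ∉ available cache V ↔ Disjoint V (holders cache p) := by
  simp [available, holders, Finset.disjoint_left]

theorem available_mono {Λ N B : ℕ} {cache : Fin Λ → Finset (Fin N × Fin B)}
    {U V : Finset (Fin Λ)} (h : U ⊆ V) : available cache U ⊆ available cache V :=
  Finset.biUnion_subset_biUnion_of_subset_left _ h

theorem missing_eq_sum {Λ N B : ℕ} (cache : Fin Λ → Finset (Fin N × Fin B))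
    (V : Finset (Fin Λ)) :
    missing cache V = ∑ p, if Disjoint V (holders cache p) then 1 else 0 := by
  simp only [missing, Finset.card_eq_sum_ones, Finset.sum_boole, Nat.cast_id]
  congr 1
  ext p
  simp [notMem_available_iff]

/-- If the users can decode one after the other, the user `u` knowing in addition the content of the
caches in `V u`, then the broadcast carries all bits wanted by `u` and missing from `V u`. -/
theorem Delivery.card_le_length {Λ N B : ℕ} {cache : Fin Λ → Finset (Fin N × Fin B)}
    {b : Finset (Fin Λ) → ℕ} {d : Demand N b} (D : Delivery cache b d)
    (V : User b → Finset (Fin Λ)) (r : User b → ℕ) (hV : ∀ u, u.1 ⊆ V u)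
    (hr : ∀ u v, r u ≤ r v → V u ⊆ V v) :
    (Finset.univ.filter fun p : Fin N × Fin B =>
      ∃ u, p.1 = d u ∧ p ∉ available cache (V u)).card ≤ D.length := by
  classical
  set A := Finset.univ.filter fun p : Fin N × Fin B => ∃ u, p.1 = d u ∧ p ∉ available cache (V u)
  -- Libraries that vary only on the counted bits: the broadcast must distinguish all of them.
  let lib : (A → Bool) → Library N B := fun x n i => if h : (n, i) ∈ A then x ⟨(n, i), h⟩ else false
  have hinj : Function.Injective fun x => D.encode (lib x) := by
    intro x y hxy
    have key : ∀ (m : ℕ) (u : User b), r u = m → lib x (d u) = lib y (d u) := by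
      intro m
      induction m using Nat.strong_induction_on with
      | _ m ih =>
        intro u hu
        rw [← D.correct (lib x) u, ← D.correct (lib y) u]
        have hxy' : D.encode (lib x) = D.encode (lib y) := hxy
        rw [hxy']
        congr 1
        ext ⟨p, hp⟩
        by_cases hpA : p ∈ A
        · obtain ⟨v, hv, hpv⟩ := (Finset.mem_filter.1 hpA).2
          -- A counted bit cached by `u` is wanted by a user of lower rank, since otherwise `V v`
          -- would contain it; that user's file is already determined.
          have hlt : r v < m := by
            by_contra! hle
            exact hpv (available_mono ((hV u).trans (hr u v (hu ▸ hle))) hp)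
          have := ih _ hlt v rfl
          simp only [hv, this]
        · simp [lib, hpA]
    ext ⟨p, hp⟩
    obtain ⟨u, hu, -⟩ := (Finset.mem_filter.1 hp).2
    have := congrFun (key _ u rfl) p.2
    rw [← hu] at this
    simpa [lib, hp] using this
  have := Fintype.card_le_of_injective _ hinj
  simp only [Fintype.card_fun, Fintype.card_bool, Fintype.card_fin, Fintype.card_coe] at this
  exact (Nat.pow_le_pow_iff_right (by norm_num)).1 this

theorem Delivery.sum_card_le_length {Λ N B : ℕ} {cache : Fin Λ → Finset (Fin N × Fin B)}
    {b : Finset (Fin Λ) → ℕ} {d : Demand N b} (D : Delivery cache b d)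
    (hd : Function.Injective d)
    (V : User b → Finset (Fin Λ)) (r : User b → ℕ) (hV : ∀ u, u.1 ⊆ V u)
    (hr : ∀ u v, r u ≤ r v → V u ⊆ V v) :
    ∑ u, (Finset.univ.filter fun p : Fin N × Fin B =>
      p.1 = d u ∧ p ∉ available cache (V u)).card ≤ D.length := by
  classical
  refine le_trans (le_of_eq ?_) (D.card_le_length V r hV hr)
  rw [← Finset.card_biUnion]
  · congr 1
    ext p
    simp
  · intro u _ v _ huv
    rw [Function.onFun, Finset.disjoint_left]
    intro p hp hq
    simp only [Finset.mem_filter] at hp hq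
    exact huv (hd (hp.2.1.symm.trans hq.2.1))

/-- The largest number of transmitted bits over all demands. -/
def Scheme.worstCaseLength {Λ K N : ℕ} {M : ℝ} (S : Scheme Λ K N M) (b : ensemble Λ K) : ℕ :=
  Finset.univ.sup fun d : Demand N b.1 => (S.delivery b d).length

/-- Since `K ≤ N`, some demand is injective. Over its `N` cyclic shifts each user requests every
file exactly once, so the per-file counts add up to `missing`. -/
theorem Scheme.sum_missing_user_le {Λ K N : ℕ} {M : ℝ} (hN : 1 ≤ N) (hKN : K ≤ N)
    (S : Scheme Λ K N M) (b : ensemble Λ K)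
    (V : User b.1 → Finset (Fin Λ)) (r : User b.1 → ℕ) (hV : ∀ u, u.1 ⊆ V u)
    (hr : ∀ u v, r u ≤ r v → V u ⊆ V v) :
    ∑ u, missing S.cache (V u) ≤ N * S.worstCaseLength b := by
  classical
  have : NeZero N := ⟨by omega⟩
  have hcard : Fintype.card (User b.1) ≤ Fintype.card (Fin N) := by
    simpa [mem_ensemble.1 b.2] using hKN
  obtain ⟨e⟩ := Function.Embedding.nonempty_of_card_le hcard
  have h1 : ∀ s : Fin N, ∑ u, (Finset.univ.filter fun p : Fin N × Fin S.fileSize =>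
      p.1 = e u + s ∧ p ∉ available S.cache (V u)).card ≤ S.worstCaseLength b := by
    intro s
    refine le_trans ((S.delivery b fun u => e u + s).sum_card_le_length ?_ V r hV hr) ?_
    · exact (add_left_injective s).comp e.injective
    · exact Finset.le_sup (f := fun d : Demand N b.1 => (S.delivery b d).length) (Finset.mem_univ _)
  have h2 := Finset.sum_le_sum fun s (_ : s ∈ Finset.univ) => h1 s
  rw [Finset.sum_comm] at h2
  simp only [Finset.sum_const, Finset.card_univ, Fintype.card_fin, smul_eq_mul] at h2
  refine le_trans (le_of_eq ?_) h2
  refine Finset.sum_congr rfl fun u _ => ?_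
  rw [← Finset.card_biUnion]
  · unfold missing
    congr 1
    ext p
    simp only [Finset.mem_compl, Finset.mem_biUnion, Finset.mem_univ, true_and, Finset.mem_filter]
    refine ⟨fun h => ⟨p.1 - e u, by simp, h⟩, fun ⟨_, _, h⟩ => h⟩
  · intro s _ t _ hst
    rw [Function.onFun, Finset.disjoint_left]
    intro p hp hq
    simp only [Finset.mem_filter] at hp hq
    exact hst (add_left_cancel (hp.2.1.symm.trans hq.2.1))

theorem Scheme.sum_missing_le {Λ K N : ℕ} {M : ℝ} (hN : 1 ≤ N) (hKN : K ≤ N)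
    (S : Scheme Λ K N M) (b : ensemble Λ K)
    (V : Finset (Fin Λ) → Finset (Fin Λ)) (r : Finset (Fin Λ) → ℕ) (hV : ∀ U, U ⊆ V U)
    (hr : ∀ U U', r U ≤ r U' → V U ⊆ V U') :
    ∑ U, b.1 U * missing S.cache (V U) ≤ N * S.worstCaseLength b := by
  have := S.sum_missing_user_le hN hKN b (fun u => V u.1) (fun u => r u.1) (fun u => hV _)
    (fun u v h => hr _ _ h)
  rw [Fintype.sum_sigma] at this
  simpa using this

/-- The connectivity in which all users have access to exactly the caches in `U`. -/
def concentrated {Λ : ℕ} (K : ℕ) (U : Finset (Fin Λ)) : ensemble Λ K :=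
  ⟨Pi.single U K, mem_ensemble.2 (by simp)⟩

theorem concentrated_injective {Λ K : ℕ} (hK : K ≠ 0) :
    Function.Injective (concentrated (Λ := Λ) K) := by
  intro U U' h
  have h1 := congrFun (congrArg Subtype.val h) U
  by_contra hne
  simp [concentrated, Pi.single_eq_of_ne hne, hK] at h1

theorem Scheme.missing_concentrated_le {Λ K N : ℕ} {M : ℝ} (hN : 1 ≤ N) (hKN : K ≤ N)
    (S : Scheme Λ K N M) (U : Finset (Fin Λ)) :
    K * missing S.cache U ≤ N * S.worstCaseLength (concentrated K U) := by
  refine le_trans (le_of_eq ?_) (S.sum_missing_user_le hN hKN (concentrated K U)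
    (fun _ => U) (fun _ => 0) ?_ (fun _ _ _ => subset_rfl))
  · have := mem_ensemble.1 (concentrated K U).2
    simp [this]
  · rintro ⟨U', k⟩
    by_cases h : U' = U
    · simp [h]
    · have hk := k.2
      simp [concentrated, Pi.single_eq_of_ne h] at hk

/-! ### The ensemble -/

theorem card_ensemble (Λ K : ℕ) : (ensemble Λ K).card = (K + 2 ^ Λ - 1).choose K := by
  have e : Sym (Finset (Fin Λ)) K ≃ {x // x ∈ ensemble Λ K} :=
    (Sym.equivNatSumOfFintype (Finset (Fin Λ)) K).trans
      (Equiv.subtypeEquivRight fun b => by rw [mem_ensemble])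
  have := Fintype.card_congr e
  rw [Fintype.card_coe, Sym.card_sym_eq_choose, Fintype.card_finset, Fintype.card_fin] at this
  rw [← this, add_comm]

theorem two_pow_le_card_ensemble {Λ K : ℕ} (hK : K ≠ 0) : 2 ^ Λ ≤ (ensemble Λ K).card := by
  have := Fintype.card_le_of_injective _ (concentrated_injective (Λ := Λ) hK)
  simpa using this

/-- Swapping two coordinates permutes the ensemble, so all `2 ^ Λ` coordinates have the same total.
-/
theorem sum_ensemble_apply {Λ K : ℕ} (U : Finset (Fin Λ)) :
    2 ^ Λ * ∑ b : ensemble Λ K, b.1 U = K * (ensemble Λ K).card := by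
  classical
  have hsymm : ∀ U', ∑ b : ensemble Λ K, b.1 U' = ∑ b : ensemble Λ K, b.1 U := by
    intro U'
    let σ : ensemble Λ K ≃ ensemble Λ K :=
      ((Equiv.swap U U').arrowCongr (Equiv.refl ℕ)).subtypeEquiv fun b => by
        rw [mem_ensemble, mem_ensemble]
        simp only [Equiv.arrowCongr_apply, Function.comp_apply, Equiv.refl_apply]
        rw [Equiv.sum_comp (Equiv.swap U U').symm b]
    rw [← Equiv.sum_comp σ]
    refine Finset.sum_congr rfl fun b _ => ?_
    simp [σ]
  have h : ∑ U', ∑ b : ensemble Λ K, b.1 U' = 2 ^ Λ * ∑ b : ensemble Λ K, b.1 U := by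
    rw [Finset.sum_congr rfl fun U' _ => hsymm U', Finset.sum_const, Finset.card_univ,
      Fintype.card_finset, Fintype.card_fin, smul_eq_mul]
  rw [← h, Finset.sum_comm, Finset.sum_congr rfl fun b _ => mem_ensemble.1 b.2]
  simp [mul_comm]

theorem Scheme.missing_le_sum_worstCaseLength {Λ K N : ℕ} {M : ℝ} (hK : K ≠ 0) (hN : 1 ≤ N) (hKN : K ≤ N)
    (S : Scheme Λ K N M)
    (V : Finset (Fin Λ) → Finset (Fin Λ)) (r : Finset (Fin Λ) → ℕ) (hV : ∀ U, U ⊆ V U)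
    (hr : ∀ U U', r U ≤ r U' → V U ⊆ V U') :
    ((K * (ensemble Λ K).card / 2 ^ Λ - K : ℝ) * ∑ U, (missing S.cache (V U) : ℝ)) +
      K * ∑ U, (missing S.cache U : ℝ) ≤ N * ∑ b, (S.worstCaseLength b : ℝ) := by
  have hgain : ∀ b : ensemble Λ K, (0 : ℝ) ≤
      N * S.worstCaseLength b - ∑ U, (b.1 U : ℝ) * missing S.cache (V U) := by
    intro b
    have := S.sum_missing_le hN hKN b V r hV hr
    rw [sub_nonneg]
    exact_mod_cast this
  -- Every connectivity has nonnegative slack in the prefix bound; only the slack of the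
  -- concentrated ones is retained, where the sharper bound is known.
  have h1 := Finset.sum_le_univ_sum_of_nonneg hgain
    (s := Finset.univ.map ⟨concentrated K, concentrated_injective hK⟩)
  rw [Finset.sum_map] at h1
  have h2 : ∀ U : Finset (Fin Λ), (K : ℝ) * missing S.cache U - K * missing S.cache (V U) ≤
      N * S.worstCaseLength (concentrated K U) -
        ∑ U', ((concentrated K U).1 U' : ℝ) * missing S.cache (V U') := by
    intro U
    have h3 : (K : ℝ) * missing S.cache U ≤ N * S.worstCaseLength (concentrated K U) := by
      exact_mod_cast S.missing_concentrated_le hN hKN U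
    have h4 : ∑ U', ((concentrated K U).1 U' : ℝ) * missing S.cache (V U') =
        K * missing S.cache (V U) := by
      rw [Finset.sum_eq_single U]
      · simp [concentrated]
      · intro U' _ hne
        simp [concentrated, Pi.single_eq_of_ne hne]
      · simp
    rw [h4]
    linarith
  have h5 := (Finset.sum_le_sum fun U (_ : U ∈ Finset.univ) => h2 U).trans h1
  have h6 : ∑ b : ensemble Λ K, ∑ U, (b.1 U : ℝ) * missing S.cache (V U) =
      K * (ensemble Λ K).card / 2 ^ Λ * ∑ U, (missing S.cache (V U) : ℝ) := by
    rw [Finset.sum_comm, Finset.mul_sum]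
    refine Finset.sum_congr rfl fun U _ => ?_
    rw [← Finset.sum_mul]
    congr 1
    rw [eq_div_iff (by positivity), mul_comm]
    exact_mod_cast sum_ensemble_apply U
  rw [Finset.sum_sub_distrib, Finset.sum_sub_distrib, h6, ← Finset.mul_sum, ← Finset.mul_sum,
    ← Finset.mul_sum] at h5
  linarith


/-! ### Averaging over the permutations of the caches -/

theorem exists_perm_map_eq {α : Type*} [Fintype α] [DecidableEq α] {P Q : Finset α}
    (h : P.card = Q.card) : ∃ σ : Equiv.Perm α, P.map σ.toEmbedding = Q := by
  let e : {x // x ∈ P} ≃ {x // x ∈ Q} := Finset.equivOfCardEq h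
  refine ⟨e.extendSubtype, ?_⟩
  refine Finset.eq_of_subset_of_card_le ?_ (by simp [h])
  intro x hx
  obtain ⟨y, hy, rfl⟩ := Finset.mem_map.1 hx
  exact e.extendSubtype_mem y hy

/-- The number of permutations that make `P` disjoint from `T`. -/
theorem card_perm_disjoint {α : Type*} [Fintype α] [DecidableEq α] (P T : Finset α) :
    (∑ σ : Equiv.Perm α, if Disjoint (P.map σ.toEmbedding) T then 1 else 0) *
        (Fintype.card α).choose P.card =
      (Fintype.card α).factorial * (Fintype.card α - T.card).choose P.card := by
  -- Double counting of pairs `(Q, σ)`: the count over `σ` depends only on the size of `Q`, by right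
  -- translation, and for fixed `σ` the admissible `Q` avoid the preimage of `T`.
  have hconst : ∀ Q ∈ Finset.powersetCard P.card (Finset.univ : Finset α),
      (∑ σ : Equiv.Perm α, if Disjoint (Q.map σ.toEmbedding) T then 1 else 0) =
        ∑ σ : Equiv.Perm α, if Disjoint (P.map σ.toEmbedding) T then 1 else 0 := by
    intro Q hQ
    obtain ⟨τ, rfl⟩ := exists_perm_map_eq (Finset.mem_powersetCard.1 hQ).2.symm
    rw [← Equiv.sum_comp (Equiv.mulRight τ) fun σ : Equiv.Perm α =>
      if Disjoint (P.map σ.toEmbedding) T then 1 else 0]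
    refine Finset.sum_congr rfl fun σ _ => ?_
    rw [Finset.map_map]
    rfl
  have hfix : ∀ σ : Equiv.Perm α, (∑ Q ∈ Finset.powersetCard P.card (Finset.univ : Finset α),
      if Disjoint (Q.map σ.toEmbedding) T then 1 else 0) =
        (Fintype.card α - T.card).choose P.card := by
    intro σ
    rw [Finset.sum_boole, Nat.cast_id]
    have : (Finset.powersetCard P.card (Finset.univ : Finset α)).filter
        (fun Q => Disjoint (Q.map σ.toEmbedding) T) =
        Finset.powersetCard P.card ((T.map σ.symm.toEmbedding)ᶜ) := by
      ext Q
      rw [Finset.mem_filter, Finset.mem_powersetCard, Finset.mem_powersetCard, and_comm,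
        and_iff_right (Finset.subset_univ Q)]
      simp only [Finset.disjoint_left, Finset.subset_iff, Finset.mem_compl, Finset.mem_map_equiv,
        Equiv.symm_symm]
      refine and_congr_left fun _ => ⟨fun h x hx => ?_, fun h x hx => ?_⟩
      · exact h (a := σ x) (by simpa using hx)
      · simpa using h hx
    rw [this, Finset.card_powersetCard, Finset.card_compl, Finset.card_map]
  have h := Finset.sum_comm (s := Finset.powersetCard P.card (Finset.univ : Finset α))
    (t := (Finset.univ : Finset (Equiv.Perm α)))
    (f := fun Q σ => if Disjoint (Q.map σ.toEmbedding) T then 1 else 0)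
  rw [Finset.sum_congr rfl hconst, Finset.sum_congr rfl fun σ _ => hfix σ] at h
  simpa [Fintype.card_perm, mul_comm] using h

/-- The first `j` caches. -/
def initial (Λ j : ℕ) : Finset (Fin Λ) :=
  Finset.univ.filter fun c => c.val < j

/-- The least number of first caches that include `U`. -/
def prefixLength {Λ : ℕ} (U : Finset (Fin Λ)) : ℕ :=
  U.sup fun c => c.val + 1

theorem subset_initial {Λ : ℕ} (U : Finset (Fin Λ)) : U ⊆ initial Λ (prefixLength U) := by
  intro c hc
  have := Finset.le_sup (f := fun c : Fin Λ => c.val + 1) hc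
  simpa [initial, prefixLength] using this

theorem initial_mono {Λ i j : ℕ} (h : i ≤ j) : initial Λ i ⊆ initial Λ j := by
  intro c hc
  simp only [initial, Finset.mem_filter, Finset.mem_univ, true_and] at hc ⊢
  omega

theorem prefixLength_le {Λ : ℕ} (U : Finset (Fin Λ)) : prefixLength U ≤ Λ :=
  Finset.sup_le fun c _ => c.2

theorem card_initial {Λ j : ℕ} (h : j ≤ Λ) : (initial Λ j).card = j := by
  simp [initial, Fin.card_filter_val_lt, h]

theorem sum_perm_missing_initial {Λ N B j : ℕ} (hj : j ≤ Λ)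
    (cache : Fin Λ → Finset (Fin N × Fin B)) :
    (∑ σ : Equiv.Perm (Fin Λ), (missing cache ((initial Λ j).map σ.toEmbedding) : ℝ)) =
      Λ.factorial * ∑ p, ((Λ - (holders cache p).card).choose j : ℝ) / Λ.choose j := by
  simp_rw [missing_eq_sum]
  push_cast
  rw [Finset.sum_comm, Finset.mul_sum]
  refine Finset.sum_congr rfl fun p _ => ?_
  have h := card_perm_disjoint (initial Λ j) (holders cache p)
  rw [card_initial hj, Fintype.card_fin] at h
  have hpos : (0 : ℝ) < Λ.choose j := by exact_mod_cast Nat.choose_pos hj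
  rw [← mul_div_assoc, eq_div_iff hpos.ne']
  exact_mod_cast h

theorem sum_missing_eq {Λ N B : ℕ} (cache : Fin Λ → Finset (Fin N × Fin B)) :
    ∑ U, missing cache U = ∑ p, 2 ^ (Λ - (holders cache p).card) := by
  simp_rw [missing_eq_sum]
  rw [Finset.sum_comm]
  refine Finset.sum_congr rfl fun p _ => ?_
  rw [Finset.sum_boole, Nat.cast_id]
  have : (Finset.univ.filter fun U => Disjoint U (holders cache p)) =
      ((holders cache p)ᶜ).powerset := by
    ext U
    simp [Finset.subset_compl_iff_disjoint_right]
  rw [this, Finset.card_powerset, Finset.card_compl, Fintype.card_fin]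

/-- The corner ordinates, as a function that is visibly convex and antitone in `t`. -/
noncomputable def profile (Λ K t : ℕ) : ℝ :=
  ((K : ℝ) / 2 ^ Λ - K / (ensemble Λ K).card) *
      ∑ U : Finset (Fin Λ), ((Λ - t).choose (prefixLength U) : ℝ) / Λ.choose (prefixLength U) +
    K / (ensemble Λ K).card * 2 ^ (Λ - t)

theorem card_ensemble_pos (Λ K : ℕ) : 0 < (ensemble Λ K).card :=
  Finset.card_pos.2 ⟨_, (concentrated K (∅ : Finset (Fin Λ))).2⟩

theorem Scheme.sum_profile_le {Λ K N : ℕ} {M : ℝ} (hK : K ≠ 0) (hN : 1 ≤ N) (hKN : K ≤ N)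
    (S : Scheme Λ K N M) :
    (ensemble Λ K).card * ∑ p, profile Λ K (holders S.cache p).card ≤
      N * ∑ b, (S.worstCaseLength b : ℝ) := by
  have hσ : ∀ σ : Equiv.Perm (Fin Λ),
      ((K * (ensemble Λ K).card / 2 ^ Λ - K : ℝ) * ∑ U : Finset (Fin Λ),
        (missing S.cache ((initial Λ (prefixLength U)).map σ.toEmbedding) : ℝ)) +
      K * ∑ U, (missing S.cache U : ℝ) ≤ N * ∑ b, (S.worstCaseLength b : ℝ) := by
    intro σ
    have := S.missing_le_sum_worstCaseLength hK hN hKN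
      (fun U => (initial Λ (prefixLength (σ.symm.finsetCongr U))).map σ.toEmbedding)
      (fun U => prefixLength (σ.symm.finsetCongr U)) ?_ ?_
    -- The sum runs over all `U`, so relabelling by `σ` leaves the permutation only in the prefix.
    · rwa [Equiv.sum_comp σ.symm.finsetCongr fun U =>
        (missing S.cache ((initial Λ (prefixLength U)).map σ.toEmbedding) : ℝ)] at this
    · intro U c hc
      rw [Finset.mem_map_equiv]
      apply subset_initial
      simpa using hc
    · intro U U' h
      exact Finset.map_subset_map.2 (initial_mono h)
  have hsum := Finset.sum_le_sum fun σ (_ : σ ∈ Finset.univ) => hσ σ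
  rw [Finset.sum_add_distrib, ← Finset.mul_sum, Finset.sum_comm,
    Finset.sum_congr rfl fun U _ => sum_perm_missing_initial (prefixLength_le U) S.cache,
    ← Finset.mul_sum, Finset.sum_const, Finset.sum_const, Finset.card_univ, Fintype.card_perm,
    Fintype.card_fin, nsmul_eq_mul, nsmul_eq_mul, Finset.sum_comm] at hsum
  have h2 : ∑ U, (missing S.cache U : ℝ) = ∑ p, 2 ^ (Λ - (holders S.cache p).card) := by
    exact_mod_cast sum_missing_eq S.cache
  rw [h2] at hsum
  have hf : (0 : ℝ) < Λ.factorial := by exact_mod_cast Λ.factorial_pos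
  have hm : (0 : ℝ) < (ensemble Λ K).card := by exact_mod_cast card_ensemble_pos Λ K
  refine le_of_mul_le_mul_left (le_trans (le_of_eq ?_) hsum) hf
  simp only [profile]
  rw [Finset.sum_add_distrib, ← Finset.mul_sum, ← Finset.mul_sum]
  field_simp

/-! ### The corner points -/

/-- Exactly `2 ^ j` subsets have maximum `j`; the empty set gives `g 0`. -/
theorem sum_powerset_range_sup {β : Type*} [AddCommMonoid β] (g : ℕ → β) (n : ℕ) :
    ∑ U ∈ (Finset.range n).powerset, g (U.sup Nat.succ) =
      g 0 + ∑ j ∈ Finset.range n, 2 ^ j • g (j + 1) := by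
  induction n with
  | zero => simp
  | succ n ih =>
    rw [Finset.range_add_one, Finset.sum_powerset_insert (by simp), ih,
      Finset.sum_insert (by simp)]
    have : ∀ U ∈ (Finset.range n).powerset, g ((insert n U).sup Nat.succ) = g (n + 1) := by
      intro U hU
      rw [Finset.sup_insert, sup_eq_left.2]
      refine Finset.sup_le fun i hi => ?_
      have := Finset.mem_range.1 (Finset.mem_powerset.1 hU hi)
      change i + 1 ≤ n + 1
      omega
    rw [Finset.sum_congr rfl this]
    simp [add_comm, add_left_comm]

theorem sum_prefixLength {β : Type*} [AddCommMonoid β] (g : ℕ → β) (n : ℕ) :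
    ∑ U : Finset (Fin n), g (prefixLength U) =
      g 0 + ∑ j ∈ Finset.range n, 2 ^ j • g (j + 1) := by
  rw [← sum_powerset_range_sup]
  refine Finset.sum_bij (fun U _ => U.map Fin.valEmbedding) ?_ ?_ ?_ ?_
  · intro U _
    rw [Finset.mem_powerset]
    intro i hi
    obtain ⟨c, -, rfl⟩ := Finset.mem_map.1 hi
    simp
  · intro U _ U' _ h
    exact Finset.map_injective _ h
  · intro U hU
    refine ⟨Finset.univ.filter fun c => c.val ∈ U, Finset.mem_univ _, ?_⟩
    ext i
    simp only [Finset.mem_map, Finset.mem_filter, Finset.mem_univ, true_and,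
      Fin.valEmbedding_apply]
    refine ⟨?_, fun hi => ⟨⟨i, Finset.mem_range.1 (Finset.mem_powerset.1 hU hi)⟩, hi, rfl⟩⟩
    rintro ⟨c, hc, rfl⟩
    exact hc
  · intro U _
    rw [Finset.sup_map]
    rfl

/-- Both sides count subsets with at least `t` elements, those with more than `t` being classified
by their `(t+1)`-th largest element. The induction uses Pascal's rule. -/
theorem choose_add_sum_two_pow_mul_choose (n t : ℕ) :
    n.choose t + ∑ j ∈ Finset.range n, 2 ^ j * (n - (j + 1)).choose t =
      ∑ l ∈ Finset.range (n + 1), n.choose (t + l) := by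
  induction n with
  | zero => simp
  | succ n ih =>
    rw [Finset.sum_range_succ', Finset.sum_range_succ']
    simp only [Nat.add_sub_add_right, pow_succ, ← add_assoc, Nat.choose_succ_succ,
      Finset.sum_add_distrib]
    have h1 : ∑ j ∈ Finset.range n, 2 ^ j * 2 * (n - (j + 1)).choose t =
        2 * ∑ j ∈ Finset.range n, 2 ^ j * (n - (j + 1)).choose t := by
      rw [Finset.mul_sum]
      exact Finset.sum_congr rfl fun j _ => by ring
    have h2 := Finset.sum_range_succ (fun l => n.choose (t + l)) (n + 1)
    rw [Finset.sum_range_succ', Nat.choose_eq_zero_of_lt (by omega : n < t + (n + 1))] at h2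
    simp only [← add_assoc, add_zero] at h2
    simp only [h1, pow_zero, one_mul, add_zero, Nat.sub_zero, Nat.succ_eq_add_one]
    omega

/-- Both sides count ordered pairs of disjoint subsets of sizes `t` and `j`. -/
theorem choose_mul_choose_sub (n t j : ℕ) :
    n.choose t * (n - t).choose j = n.choose j * (n - j).choose t := by
  have h1 := Nat.choose_mul (n := n) (k := t + j) (s := t) (by omega)
  have h2 := Nat.choose_mul (n := n) (k := t + j) (s := j) (by omega)
  rw [Nat.add_sub_cancel_left] at h1
  rw [Nat.add_sub_cancel] at h2
  rw [← h1, ← h2, Nat.choose_symm_add]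

theorem sum_choose_prefixLength_div {Λ t : ℕ} (ht : t ≤ Λ) :
    ∑ U : Finset (Fin Λ), ((Λ - t).choose (prefixLength U) : ℝ) / Λ.choose (prefixLength U) =
      ∑ l ∈ Finset.range (Λ + 1), (Λ.choose (t + l) : ℝ) / Λ.choose t := by
  have h0 : (0 : ℝ) < Λ.choose t := by exact_mod_cast Nat.choose_pos ht
  have h1 : ∀ U : Finset (Fin Λ),
      ((Λ - t).choose (prefixLength U) : ℝ) / Λ.choose (prefixLength U) =
        ((Λ - prefixLength U).choose t : ℝ) / Λ.choose t := by
    intro U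
    have h2 : (0 : ℝ) < Λ.choose (prefixLength U) := by
      exact_mod_cast Nat.choose_pos (prefixLength_le U)
    rw [div_eq_div_iff h2.ne' h0.ne', mul_comm, mul_comm _ (Λ.choose (prefixLength U) : ℝ)]
    exact_mod_cast choose_mul_choose_sub Λ t (prefixLength U)
  rw [Finset.sum_congr rfl fun U _ => h1 U, ← Finset.sum_div, ← Finset.sum_div]
  congr 1
  have h3 := sum_prefixLength (fun j => (Λ - j).choose t) Λ
  simp only [Nat.sub_zero, smul_eq_mul] at h3
  rw [choose_add_sum_two_pow_mul_choose] at h3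
  exact_mod_cast h3

/-- The identity `h2` splits `A_{t,λ}` into a part summing to the power of two and a part that
corrects the coefficient of the prefix sum. -/
theorem cornerLoad_eq_profile {Λ K t : ℕ} (ht : t ≤ Λ) : cornerLoad Λ K t = profile Λ K t := by
  have h0 : (0 : ℝ) < Λ.choose t := by exact_mod_cast Nat.choose_pos ht
  have hm : (0 : ℝ) < (ensemble Λ K).card := by exact_mod_cast card_ensemble_pos Λ K
  have hpow : (2 : ℝ) ^ (Λ - t) = ∑ l ∈ Finset.range (Λ + 1), ((Λ - t).choose l : ℝ) := by
    have h1 : 2 ^ (Λ - t) = ∑ l ∈ Finset.range (Λ + 1), (Λ - t).choose l := by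
      rw [← Nat.sum_range_choose]
      refine Finset.sum_subset (Finset.range_subset_range.2 (by omega)) fun l _ hl => ?_
      exact Nat.choose_eq_zero_of_lt (by simpa using hl)
    exact_mod_cast h1
  rw [profile, sum_choose_prefixLength_div ht, hpow, cornerLoad, Finset.mul_sum, Finset.mul_sum,
    ← Finset.sum_add_distrib]
  refine Finset.sum_congr rfl fun l _ => ?_
  have h1 : (0 : ℝ) < (t + l).choose l := by exact_mod_cast Nat.choose_pos (by omega)
  have h2 : ((Λ - t).choose l : ℝ) = Λ.choose (t + l) * (t + l).choose l / Λ.choose t := by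
    rw [eq_div_iff h0.ne']
    have h3 := Nat.choose_mul (n := Λ) (k := t + l) (s := t) (by omega)
    rw [Nat.add_sub_cancel_left, Nat.choose_symm_add] at h3
    rw [mul_comm]
    exact_mod_cast h3.symm
  rw [extraTerm, h2]
  field_simp
  ring

/-! ### Convexity -/

theorem two_mul_choose_sub_le (n t j : ℕ) :
    2 * (n - (t + 1)).choose j ≤ (n - t).choose j + (n - (t + 2)).choose j := by
  rcases j with _ | j
  · simp
  by_cases h : t + 2 ≤ n
  · obtain ⟨m, rfl⟩ := Nat.exists_eq_add_of_le h
    rw [show t + 2 + m - t = m + 1 + 1 by omega, show t + 2 + m - (t + 1) = m + 1 by omega,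
      show t + 2 + m - (t + 2) = m by omega]
    have : m.choose j ≤ (m + 1).choose j := Nat.choose_le_succ m j
    rw [Nat.choose_succ_succ' (m + 1) j, Nat.choose_succ_succ' m j]
    omega
  -- Truncated subtraction makes the last two terms equal, so monotonicity suffices.
  · rw [show n - (t + 2) = n - (t + 1) by omega, two_mul]
    exact Nat.add_le_add_right (Nat.choose_le_choose _ (by omega)) _

theorem two_mul_two_pow_sub_le (n t : ℕ) :
    2 * 2 ^ (n - (t + 1)) ≤ 2 ^ (n - t) + 2 ^ (n - (t + 2)) := by
  by_cases h : t + 1 ≤ n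
  · rw [show n - t = n - (t + 1) + 1 by omega, pow_succ]
    have := Nat.one_le_two_pow (n := n - (t + 2))
    omega
  · rw [show n - (t + 2) = n - t by omega, show n - (t + 1) = n - t by omega]
    omega

theorem profile_coeff_nonneg {Λ K : ℕ} (hK : K ≠ 0) :
    (0 : ℝ) ≤ (K : ℝ) / 2 ^ Λ - K / (ensemble Λ K).card := by
  rw [sub_nonneg]
  have : ((2 : ℝ) ^ Λ) ≤ (ensemble Λ K).card := by exact_mod_cast two_pow_le_card_ensemble hK
  gcongr

theorem profile_convex {Λ K : ℕ} (hK : K ≠ 0) (t : ℕ) :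
    profile Λ K (t + 1) - profile Λ K t ≤ profile Λ K (t + 2) - profile Λ K (t + 1) := by
  have h1 : 2 * (∑ U : Finset (Fin Λ),
      ((Λ - (t + 1)).choose (prefixLength U) : ℝ) / Λ.choose (prefixLength U)) ≤
      (∑ U : Finset (Fin Λ),
        ((Λ - t).choose (prefixLength U) : ℝ) / Λ.choose (prefixLength U)) +
      ∑ U : Finset (Fin Λ),
        ((Λ - (t + 2)).choose (prefixLength U) : ℝ) / Λ.choose (prefixLength U) := by
    rw [Finset.mul_sum, ← Finset.sum_add_distrib]
    refine Finset.sum_le_sum fun U _ => ?_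
    rw [← add_div, ← mul_div_assoc]
    gcongr
    exact_mod_cast two_mul_choose_sub_le Λ t (prefixLength U)
  have h2 : 2 * (2 : ℝ) ^ (Λ - (t + 1)) ≤ 2 ^ (Λ - t) + 2 ^ (Λ - (t + 2)) := by
    exact_mod_cast two_mul_two_pow_sub_le Λ t
  have h3 := mul_le_mul_of_nonneg_left h1 (profile_coeff_nonneg (Λ := Λ) hK)
  have h4 := mul_le_mul_of_nonneg_left h2
    (by positivity : (0 : ℝ) ≤ (K : ℝ) / (ensemble Λ K).card)
  simp only [profile]
  linarith

theorem profile_antitone {Λ K : ℕ} (hK : K ≠ 0) : Antitone (profile Λ K) := by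
  intro s t hst
  have h0 := profile_coeff_nonneg (Λ := Λ) hK
  unfold profile
  gcongr
  norm_num

/-- Increments are monotone, so the line through two consecutive points stays below the sequence in
both directions. -/
theorem tangent_le {c : ℕ → ℝ} (hc : ∀ t, c (t + 1) - c t ≤ c (t + 2) - c (t + 1)) (k t : ℕ) :
    c k + ((t : ℝ) - k) * (c (k + 1) - c k) ≤ c t := by
  have hmono : Monotone fun t => c (t + 1) - c t := monotone_nat_of_le_succ hc
  rcases le_total k t with h | h
  · induction t, h using Nat.le_induction with
    | base => simp
    | succ t h ih =>
      have h1 : c (k + 1) - c k ≤ c (t + 1) - c t := hmono h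
      push_cast
      linarith
  · induction h using Nat.decreasingInduction with
    | self => simp
    | of_succ t h ih =>
      have h1 : c (t + 1) - c t ≤ c (k + 1) - c k := hmono (by omega : t ≤ k)
      push_cast at ih
      linarith

/-! ### Conclusion -/

theorem sum_card_holders {Λ N B : ℕ} (cache : Fin Λ → Finset (Fin N × Fin B)) :
    ∑ p, (holders cache p).card = ∑ c, (cache c).card := by
  have := Finset.sum_card_bipartiteAbove_eq_sum_card_bipartiteBelow
    (s := (Finset.univ : Finset (Fin N × Fin B))) (t := (Finset.univ : Finset (Fin Λ)))
    (fun p c => p ∈ cache c)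
  simpa [Finset.bipartiteAbove, Finset.bipartiteBelow, holders] using this

theorem lowerBoundCurve_mul_le {Λ K N B : ℕ} {M : ℝ} (hΛ : 1 ≤ Λ) (hN : 1 ≤ N) (hK : K ≠ 0)
    (hM : 0 ≤ M) (hMN : M ≤ N) (cache : Fin Λ → Finset (Fin N × Fin B))
    (hcache : ∀ c, ((cache c).card : ℝ) ≤ M * B) :
    N * B * lowerBoundCurve Λ K N M ≤ ∑ p, profile Λ K (holders cache p).card := by
  have hN' : (0 : ℝ) < N := by exact_mod_cast hN
  have hcard : ∀ a : ℝ, ∑ _p : Fin N × Fin B, a = N * B * a := by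
    intro a
    simp
  have hle : ∀ p, (holders cache p).card ≤ Λ := fun p => by
    simpa using (holders cache p).card_le_univ
  simp only [lowerBoundCurve]
  set s : ℝ := Λ * M / N with hs
  have hs0 : 0 ≤ s := by positivity
  have hsΛ : s ≤ Λ := by
    rw [hs, div_le_iff₀ hN']
    gcongr
  set k := ⌊s⌋₊
  have hks : (k : ℝ) ≤ s := Nat.floor_le hs0
  have hkΛ : k ≤ Λ := by exact_mod_cast hks.trans hsΛ
  -- At `k = Λ` there is no next corner; the slope term has factor zero and antitonicity is enough.
  rcases hkΛ.eq_or_lt with h | h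
  · have hsk : s - k = 0 := by
      rw [h] at hks ⊢
      linarith
    rw [hsk, zero_mul, add_zero, cornerLoad_eq_profile hkΛ, ← hcard]
    refine Finset.sum_le_sum fun p _ => profile_antitone hK ?_
    rw [h]
    exact hle p
  · rw [cornerLoad_eq_profile hkΛ, cornerLoad_eq_profile h]
    have h1 := Finset.sum_le_sum fun p (_ : p ∈ Finset.univ) =>
      tangent_le (profile_convex (Λ := Λ) hK) k (holders cache p).card
    rw [Finset.sum_add_distrib, hcard, ← Finset.sum_mul, Finset.sum_sub_distrib, hcard] at h1
    have h2 : ∑ p, ((holders cache p).card : ℝ) ≤ N * B * s := by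
      have h3 : ∑ p, ((holders cache p).card : ℝ) = ∑ c, ((cache c).card : ℝ) := by
        exact_mod_cast sum_card_holders cache
      rw [h3]
      refine (Finset.sum_le_sum fun c _ => hcache c).trans (le_of_eq ?_)
      rw [hs]
      simp only [Finset.sum_const, Finset.card_univ, Fintype.card_fin, nsmul_eq_mul]
      field_simp
    -- The nonpositive slope turns the upper bound on cached copies into a lower bound on the load.
    have h4 : profile Λ K (k + 1) - profile Λ K k ≤ 0 :=
      sub_nonpos.2 (profile_antitone hK (Nat.le_succ k))
    have h5 := mul_le_mul_of_nonpos_right h2 h4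
    linarith

theorem Scheme.averageLoad_nonneg {Λ K N : ℕ} {M : ℝ} (S : Scheme Λ K N M) :
    0 ≤ S.averageLoad := by
  unfold Scheme.averageLoad Scheme.worstCaseLoad
  positivity

theorem lowerBoundCurve_zero_users (Λ N : ℕ) (M : ℝ) : lowerBoundCurve Λ 0 N M = 0 := by
  simp [lowerBoundCurve, cornerLoad, extraTerm]

theorem Scheme.lowerBoundCurve_le {Λ K N : ℕ} {M : ℝ} (hΛ : 1 ≤ Λ) (hN : 1 ≤ N) (hKN : K ≤ N)
    (hM : 0 ≤ M) (hMN : M ≤ N) (S : Scheme Λ K N M) :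
    lowerBoundCurve Λ K N M ≤ S.averageLoad := by
  -- Without users the concentrated connectivities coincide, so this case is separate.
  rcases eq_or_ne K 0 with rfl | hK
  · rw [lowerBoundCurve_zero_users]
    exact S.averageLoad_nonneg
  have hN' : (0 : ℝ) < N := by exact_mod_cast hN
  have hB : (0 : ℝ) < S.fileSize := by exact_mod_cast S.fileSize_pos
  have hm : (0 : ℝ) < (ensemble Λ K).card := by exact_mod_cast card_ensemble_pos Λ K
  have h1 := lowerBoundCurve_mul_le hΛ hN hK hM hMN S.cache S.cache_card_le
  have h2 := (mul_le_mul_of_nonneg_left h1 hm.le).trans (S.sum_profile_le hK hN hKN)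
  have h3 : S.averageLoad = (∑ b, (S.worstCaseLength b : ℝ)) / S.fileSize / (ensemble Λ K).card := by
    rw [Finset.sum_div]
    rfl
  rw [h3, div_div, le_div_iff₀ (by positivity)]
  refine le_of_mul_le_mul_left (le_trans (le_of_eq ?_) h2) hN'
  ring

/-- The scheme without caching that broadcasts the whole library. -/
def broadcastScheme (Λ K N : ℕ) {M : ℝ} (hM : 0 ≤ M) : Scheme Λ K N M where
  fileSize := 1
  fileSize_pos := one_pos
  cache _ := ∅
  cache_card_le _ := by simpa using hM
  delivery _ d :=
    { length := N
      encode := fun W n => W n 0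
      decode := fun u X _ _ => X (d u)
      correct := fun W u => by
        funext i
        rw [Subsingleton.elim i 0] }

end MACC

theorem theorem3 (Λ K N : ℕ) (hΛ : 1 ≤ Λ) (hN : 1 ≤ N) (hKN : K ≤ N) :
    (MACC.ensemble Λ K).card = (K + 2 ^ Λ - 1).choose K ∧
      ∀ M : ℝ, 0 ≤ M → M ≤ N →
        MACC.lowerBoundCurve Λ K N M ≤ MACC.optimalAverageLoad Λ K N M := by
  refine ⟨MACC.card_ensemble Λ K, fun M hM hMN => ?_⟩
  -- Nonemptiness matters: the real infimum of the empty set is `0` by default.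
  refine le_csInf ⟨_, MACC.broadcastScheme Λ K N hM, le_rfl⟩ ?_
  rintro R ⟨S, hS⟩
  exact (S.lowerBoundCurve_le hΛ hN hKN hM hMN).trans hS
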